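/- Let $S$ be a finite set and, for each $\lambda>0$, let $Q(\lambda)=(q_{ij}(\lambda))_{i,j\in S}$ be an irreducible transition rate matrix on $S$; put $q_i(\lambda)=-q_{ii}(\lambda)=\sum_{j\ne i}q_{ij}(\lambda)$, and let $\Omega(\lambda)=(\omega_{ij}(\lambda))$ be the jump matrix, $\omega_{ij}(\lambda)=q_{ij}(\lambda)/q_i(\lambda)$ for $i\neq j$ and $\omega_{ii}(\lambda)=0$. Assume that for all $i\ne j$ the limit $\lim_{\lambda\to\infty}q_{ij}(\lambda)$ exists in $[0,\infty]$ and the limit $\lim_{\lambda\to\infty}\omega_{ij}(\lambda)$ exists. Let $q_i=\lim_{\lambda\to\infty}q_i(\lambda)\in[0,\infty]$, $A=\{i\in S: q_i=\infty\}$ (fast states), $B=\{i\in S: q_i<\infty\}$ (slow states), and $\Omega=\lim_{\lambda\to\infty}\Omega(\lambda)$. Assume that $B\neq\emptyset$, that $q_i>0$ for every $i\in B$, and that for every $i\in A$ the discrete-time Markov chain with transition matrix $\Omega$ started at $i$ hits $B$ with probability one. Let $Q_{BB}$ and $Q_{BA}$ be the limits as $\lambda\to\infty$ of the $B\times B$ and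 $B\times A$ blocks of $Q(\lambda)$, let $\Omega_{AA}$ and $\Omega_{AB}$ be the $A\times A$ and $A\times B$ blocks of $\Omega$, and let $$\Gamma=Q_{BB}+Q_{BA}(I-\Omega_{AA})^{-1}\Omega_{AB}.$$ Assume that the transition rate matrix $\Gamma$ on $B$ is irreducible, and let $\pi$ be a probability distribution on $S$ concentrated on $B$. For $\lambda>0$ let $(X_t)_{t\ge0}$ be, under $P^\lambda_\pi$, a continuous-time Markov chain on $S$ with transition rate matrix $Q(\lambda)$ and initial distribution $\pi$, and let $(Y_t)_{t\ge0}$ be, under $P_\pi$, a continuous-time Markov chain on $B$ with transition rate matrix $\Gamma$ and initial distribution $\pi$ (the reduced chain). Then $$\lim_{\lambda\to\infty}\ \sup_{t\ge 0}\ d_{TV}\bigl(P^\lambda_\pi(X_t\in\cdot),\,P_\pi(Y_t\in\cdot)\bigr)=0,$$ where $d_{TV}(\mu,\nu)=\frac12\sum_{i\in S}|\mu_i-\nu_i|$ and the law of $Y_t$ is regarded as a probability measure on $S$. -/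

import Mathlib

open Filter Topology MeasureTheory
open scoped NNReal

/-- A transition rate matrix: nonnegative off-diagonal entries and vanishing row sums. -/
structure IsRateMatrix {S : Type*} [Fintype S] (M : Matrix S S ℝ) : Prop where
  nonneg : ∀ i j, i ≠ j → 0 ≤ M i j
  row_sum : ∀ i, ∑ j, M i j = 0

/-- Irreducibility of a rate matrix: any state can be reached from any other one
along transitions with positive rates. -/
def RateIrreducible {S : Type*} (M : Matrix S S ℝ) : Prop :=
  ∀ i j, Relation.ReflTransGen (fun a b => a ≠ b ∧ 0 < M a b) i j

/-- The total exit rate `q_i = -q_{ii}` of a state. -/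
def exitRate {S : Type*} (M : Matrix S S ℝ) (i : S) : ℝ := -M i i

/-- The transition matrix of the jump chain: `q_{ij} / q_i` off the diagonal, `0` on it. -/
noncomputable def jumpMatrix {S : Type*} [DecidableEq S] (M : Matrix S S ℝ) : Matrix S S ℝ :=
  Matrix.of fun i j => if i = j then 0 else M i j / exitRate M i

/-- `X` is a right-continuous continuous-time Markov chain on the finite set `S` with transition
rate matrix `M` (so with transition function `t ↦ exp (t M)`) and initial distribution `init`,
defined on the probability space `(Ω, P)`. -/
structure IsMarkovChain {S Ω : Type*} [Fintype S] [DecidableEq S] [MeasurableSpace S]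
    [MeasurableSpace Ω] (P : Measure Ω) (M : Matrix S S ℝ) (init : S → ℝ)
    (X : ℝ≥0 → Ω → S) : Prop where
  prob : IsProbabilityMeasure P
  measurable : ∀ t, Measurable (X t)
  right_continuous : ∀ ω t, ∀ᶠ s in 𝓝[≥] t, X s ω = X t ω
  fdd : ∀ (n : ℕ) (t : ℕ → ℝ≥0) (x : ℕ → S), t 0 = 0 → Monotone t →
    P.real {ω | ∀ k ≤ n, X (t k) ω = x k} =
      init (x 0) * ∏ k ∈ Finset.range n,
        NormedSpace.exp (((t (k + 1) : ℝ) - (t k : ℝ)) • M) (x k) (x (k + 1))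

/-- `P` is the law, on path space, of the discrete-time Markov chain on `S` with transition
matrix `K` started at `i`. -/
structure IsDiscreteChainLaw {S : Type*} [DecidableEq S] [MeasurableSpace S]
    (K : Matrix S S ℝ) (i : S) (P : Measure (ℕ → S)) : Prop where
  prob : IsProbabilityMeasure P
  fdd : ∀ (n : ℕ) (x : ℕ → S),
    P.real {η | ∀ k ≤ n, η k = x k} =
      (if x 0 = i then 1 else 0) * ∏ k ∈ Finset.range n, K (x k) (x (k + 1))

/-- The discrete-time Markov chain with transition matrix `K` started at `i` hits `B`
with probability one. (The law of the chain is determined by `K` and `i`.) -/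
def HitsAlmostSurely {S : Type*} [DecidableEq S] [MeasurableSpace S]
    (K : Matrix S S ℝ) (i : S) (B : Set S) : Prop :=
  ∃ P : Measure (ℕ → S), IsDiscreteChainLaw K i P ∧ ∀ᵐ η ∂P, ∃ n, η n ∈ B

/-- A fast state: its exit rate tends to infinity. -/
def IsFast {S : Type*} (Q : ℝ → Matrix S S ℝ) (i : S) : Prop :=
  Tendsto (fun l => exitRate (Q l) i) atTop atTop

/-- A slow state: its exit rate has a finite limit. -/
def IsSlow {S : Type*} (Q : ℝ → Matrix S S ℝ) (i : S) : Prop :=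
  ∃ c : ℝ, Tendsto (fun l => exitRate (Q l) i) atTop (𝓝 c)

noncomputable instance {S : Type*} (Q : ℝ → Matrix S S ℝ) : DecidablePred (IsFast Q) :=
  Classical.decPred _

noncomputable instance {S : Type*} (Q : ℝ → Matrix S S ℝ) : DecidablePred (IsSlow Q) :=
  Classical.decPred _

/-- The fast state space `A`. -/
abbrev Fast {S : Type*} (Q : ℝ → Matrix S S ℝ) : Type _ := {i : S // IsFast Q i}

/-- The slow state space `B`. -/
abbrev Slow {S : Type*} (Q : ℝ → Matrix S S ℝ) : Type _ := {i : S // IsSlow Q i}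

/-- The entrywise limit of `Q(λ)` as `λ → ∞`; only rows of slow states, where the
limits are finite, are ever used. -/
noncomputable def limRate {S : Type*} (Q : ℝ → Matrix S S ℝ) : Matrix S S ℝ :=
  Matrix.of fun i j => limUnder atTop (fun l => Q l i j)

/-- The entrywise limit of the jump matrices as `λ → ∞`. -/
noncomputable def limJump {S : Type*} [DecidableEq S] (Q : ℝ → Matrix S S ℝ) : Matrix S S ℝ :=
  Matrix.of fun i j => limUnder atTop (fun l => jumpMatrix (Q l) i j)

/-- The standing assumptions on a two-time-scale family `Q(λ)`, `λ > 0`, of rate matrices. -/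
structure IsTwoTimeScale {S : Type*} [Fintype S] [DecidableEq S] [MeasurableSpace S]
    (Q : ℝ → Matrix S S ℝ) : Prop where
  rateMatrix : ∀ l, 0 < l → IsRateMatrix (Q l)
  irreducible : ∀ l, 0 < l → RateIrreducible (Q l)
  rate_limit : ∀ i j, i ≠ j →
    (∃ c : ℝ, Tendsto (fun l => Q l i j) atTop (𝓝 c)) ∨ Tendsto (fun l => Q l i j) atTop atTop
  jump_limit : ∀ i j, i ≠ j →
    ∃ c : ℝ, Tendsto (fun l => jumpMatrix (Q l) i j) atTop (𝓝 c)
  slow_nonempty : ∃ i, IsSlow Q i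
  slow_pos : ∀ i, IsSlow Q i → 0 < exitRate (limRate Q) i
  hits_slow : ∀ i, IsFast Q i → HitsAlmostSurely (limJump Q) i {j | IsSlow Q j}

/-- The rate matrix `Γ = Q_BB + Q_BA (I - Ω_AA)⁻¹ Ω_AB` of the reduced chain on `B`. -/
noncomputable def reducedRate {S : Type*} [Fintype S] [DecidableEq S]
    (Q : ℝ → Matrix S S ℝ) : Matrix (Slow Q) (Slow Q) ℝ :=
  let QBB : Matrix (Slow Q) (Slow Q) ℝ := (limRate Q).submatrix (↑) (↑)
  let QBA : Matrix (Slow Q) (Fast Q) ℝ := (limRate Q).submatrix (↑) (↑)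
  let ΩAA : Matrix (Fast Q) (Fast Q) ℝ := (limJump Q).submatrix (↑) (↑)
  let ΩAB : Matrix (Fast Q) (Slow Q) ℝ := (limJump Q).submatrix (↑) (↑)
  QBB + QBA * (1 - ΩAA)⁻¹ * ΩAB

/-- Total variation distance between probability measures on a finite set. -/
noncomputable def tvDist {S : Type*} [Fintype S] [MeasurableSpace S] (μ ν : Measure S) : ℝ :=
  (1 / 2) * ∑ i, |μ.real {i} - ν.real {i}|

section MatrixExponential

variable {S : Type*} [Fintype S] [DecidableEq S]

section Norm

attribute [local instance] Matrix.linftyOpNormedRing Matrix.linftyOpNormedAlgebra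

lemma hasDerivAt_exp_smul_apply (M : Matrix S S ℝ) (i j : S) (t : ℝ) :
    HasDerivAt (fun u : ℝ => NormedSpace.exp (u • M) i j)
      ((NormedSpace.exp (t • M) * M) i j) t := by
  have h := hasDerivAt_exp_smul_const (𝕂 := ℝ) M t
  have h1 := (hasDerivAt_pi.1 h) i
  exact (hasDerivAt_pi.1 h1) j

lemma hasSum_exp_apply (M : Matrix S S ℝ) (i j : S) :
    HasSum (fun n : ℕ => ((n.factorial : ℝ)⁻¹ • M ^ n) i j) (NormedSpace.exp M i j) := by
  have h := NormedSpace.exp_series_hasSum_exp' (𝕂 := ℝ) M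
  exact Pi.hasSum.1 (Pi.hasSum.1 h i) j

end Norm

lemma exp_zero_smul (M : Matrix S S ℝ) : NormedSpace.exp ((0 : ℝ) • M) = 1 := by
  rw [zero_smul, NormedSpace.exp_zero]

lemma exp_smul_mul_comm (M : Matrix S S ℝ) (t : ℝ) :
    NormedSpace.exp (t • M) * M = M * NormedSpace.exp (t • M) :=
  (((Commute.refl M).smul_left t).exp_left).eq

lemma pow_apply_nonneg {M : Matrix S S ℝ} (hM : ∀ i j, 0 ≤ M i j) (n : ℕ) (i j : S) :
    0 ≤ (M ^ n) i j := by
  induction n generalizing i j with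
  | zero => rw [pow_zero, Matrix.one_apply]; split_ifs <;> norm_num
  | succ n ih =>
    rw [pow_succ, Matrix.mul_apply]
    exact Finset.sum_nonneg fun k _ => mul_nonneg (ih i k) (hM k j)

lemma exp_apply_nonneg {M : Matrix S S ℝ} (hM : ∀ i j, 0 ≤ M i j) (i j : S) :
    0 ≤ NormedSpace.exp M i j :=
  (hasSum_exp_apply M i j).nonneg fun n => by
    rw [Matrix.smul_apply, smul_eq_mul]
    exact mul_nonneg (by positivity) (pow_apply_nonneg hM n i j)

lemma exp_apply_pos {M : Matrix S S ℝ} (hM : ∀ i j, 0 ≤ M i j) {i j : S} {n : ℕ}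
    (hn : 0 < (M ^ n) i j) : 0 < NormedSpace.exp M i j := by
  have hs := hasSum_exp_apply M i j
  have h0 : ∀ k : ℕ, 0 ≤ ((k.factorial : ℝ)⁻¹ • M ^ k) i j := fun k => by
    rw [Matrix.smul_apply, smul_eq_mul]
    exact mul_nonneg (by positivity) (pow_apply_nonneg hM k i j)
  refine lt_of_lt_of_le ?_ (le_hasSum hs n fun k _ => h0 k)
  rw [Matrix.smul_apply, smul_eq_mul]
  positivity

/-- Shifting by a scalar matrix only rescales the exponential. -/
lemma exp_eq_smul_exp_add_scalar (M : Matrix S S ℝ) (c : ℝ) :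
    NormedSpace.exp M = Real.exp (-c) • NormedSpace.exp (M + c • (1 : Matrix S S ℝ)) := by
  have hc : Commute M (c • (1 : Matrix S S ℝ)) := (Commute.one_right M).smul_right c
  have hd : NormedSpace.exp (c • (1 : Matrix S S ℝ)) = Real.exp c • (1 : Matrix S S ℝ) := by
    rw [← Matrix.diagonal_one, ← Matrix.diagonal_smul, Matrix.exp_diagonal,
      ← Matrix.diagonal_smul]
    congr 1
    ext i
    simp [Pi.coe_exp, Real.exp_eq_exp_ℝ]
  rw [Matrix.exp_add_of_commute _ _ hc, hd, mul_smul_comm, mul_one, smul_smul, ← Real.exp_add]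
  simp

lemma exists_add_scalar_pos {T : Type*} [Fintype T] (M : Matrix T T ℝ) :
    ∃ c : ℝ, ∀ i, 0 < M i i + c := by
  refine ⟨1 + ∑ i, |M i i|, fun i => ?_⟩
  have h1 : |M i i| ≤ ∑ i, |M i i| :=
    Finset.single_le_sum (f := fun i => |M i i|) (fun k _ => abs_nonneg _) (Finset.mem_univ i)
  have h2 := neg_abs_le (M i i)
  linarith

lemma add_scalar_apply_nonneg {T : Type*} [DecidableEq T] {M : Matrix T T ℝ}
    (hM : ∀ i j, i ≠ j → 0 ≤ M i j) {c : ℝ} (hc : ∀ i, 0 < M i i + c) (i j : T) : 0 ≤ (M + c • (1 : Matrix T T ℝ)) i j := by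
  rcases eq_or_ne i j with rfl | h
  · simpa using (hc i).le
  · simpa [Matrix.one_apply_ne h] using hM i j h

lemma exp_apply_nonneg_of_offDiag {M : Matrix S S ℝ} (hM : ∀ i j, i ≠ j → 0 ≤ M i j)
    (i j : S) : 0 ≤ NormedSpace.exp M i j := by
  obtain ⟨c, hc⟩ := exists_add_scalar_pos M
  rw [exp_eq_smul_exp_add_scalar M c, Matrix.smul_apply, smul_eq_mul]
  exact mul_nonneg (Real.exp_pos _).le (exp_apply_nonneg (add_scalar_apply_nonneg hM hc) i j)

lemma exp_smul_apply_nonneg {M : Matrix S S ℝ} (hM : ∀ i j, i ≠ j → 0 ≤ M i j)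
    {t : ℝ} (ht : 0 ≤ t) (i j : S) : 0 ≤ NormedSpace.exp (t • M) i j :=
  exp_apply_nonneg_of_offDiag (fun i j h => by
    rw [Matrix.smul_apply, smul_eq_mul]; exact mul_nonneg ht (hM i j h)) i j

lemma exp_apply_pos_of_rateIrreducible {M : Matrix S S ℝ} (hM : ∀ i j, i ≠ j → 0 ≤ M i j)
    (hirr : RateIrreducible M) (i j : S) : 0 < NormedSpace.exp M i j := by
  obtain ⟨c, hc⟩ := exists_add_scalar_pos M
  have h0 := add_scalar_apply_nonneg hM hc
  rw [exp_eq_smul_exp_add_scalar M c, Matrix.smul_apply, smul_eq_mul]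
  refine mul_pos (Real.exp_pos _) ?_
  have : ∃ n : ℕ, 0 < ((M + c • (1 : Matrix S S ℝ)) ^ n) i j := by
    induction hirr i j with
    | refl => exact ⟨0, by simp⟩
    | @tail b d _ hbd ih =>
      obtain ⟨n, hn⟩ := ih
      refine ⟨n + 1, ?_⟩
      rw [pow_succ, Matrix.mul_apply]
      refine Finset.sum_pos' (fun k _ => mul_nonneg (pow_apply_nonneg h0 n i k) (h0 k d))
        ⟨b, Finset.mem_univ b, mul_pos hn ?_⟩
      simpa [Matrix.one_apply_ne hbd.1] using hbd.2
  obtain ⟨n, hn⟩ := this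
  exact exp_apply_pos h0 hn

lemma sum_exp_smul_apply {M : Matrix S S ℝ} (hM : ∀ i, ∑ j, M i j = 0) (t : ℝ) (i : S) :
    ∑ j, NormedSpace.exp (t • M) i j = 1 := by
  have hd : ∀ u : ℝ, HasDerivAt (fun u : ℝ => ∑ j, NormedSpace.exp (u • M) i j) 0 u := by
    intro u
    have h := HasDerivAt.fun_sum (u := Finset.univ)
      fun j _ => hasDerivAt_exp_smul_apply M i j u
    refine h.congr_deriv ?_
    simp only [Matrix.mul_apply]
    rw [Finset.sum_comm]
    simp [← Finset.mul_sum, hM]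
  have hconst : ∑ j, NormedSpace.exp (t • M) i j = ∑ j, NormedSpace.exp ((0 : ℝ) • M) i j :=
    is_const_of_deriv_eq_zero (fun u => (hd u).differentiableAt) (fun u => (hd u).deriv) t 0
  rw [hconst, exp_zero_smul]
  simp [Matrix.one_apply]

/-- Derivative of `s ↦ (v s) exp ((t - s) M)` when `v' = v M + r`. -/
lemma hasDerivAt_sum_mul_exp {M : Matrix S S ℝ} {v : ℝ → S → ℝ} {r : S → ℝ} {s : ℝ}
    (hv : ∀ i, HasDerivAt (fun u => v u i) (∑ k, v s k * M k i + r i) s) (t : ℝ) (j : S) :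
    HasDerivAt (fun u => ∑ i, v u i * NormedSpace.exp ((t - u) • M) i j)
      (∑ i, r i * NormedSpace.exp ((t - s) • M) i j) s := by
  have he : ∀ i, HasDerivAt (fun u : ℝ => NormedSpace.exp ((t - u) • M) i j)
      (-(M * NormedSpace.exp ((t - s) • M)) i j) s := fun i => by
    have h := (hasDerivAt_exp_smul_apply M i j (t - s)).comp_const_sub t s
    rwa [exp_smul_mul_comm] at h
  have h := HasDerivAt.fun_sum (u := Finset.univ) fun i _ => (hv i).mul (he i)
  refine h.congr_deriv ?_
  simp only [add_mul, Finset.sum_add_distrib, Matrix.mul_apply, mul_neg, Finset.sum_neg_distrib,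
    Finset.mul_sum, Finset.sum_mul]
  rw [Finset.sum_comm]
  simp only [mul_assoc]
  ring

end MatrixExponential

section Hitting

/-- Almost surely a discrete chain only visits states reachable from its starting point. -/
lemma IsDiscreteChainLaw.ae_reachable {S : Type*} [Finite S] [DecidableEq S]
    [MeasurableSpace S] {K : Matrix S S ℝ} {i : S} {P : Measure (ℕ → S)}
    (hP : IsDiscreteChainLaw K i P) :
    ∀ᵐ η ∂P, ∀ n, Relation.ReflTransGen (fun a b => K a b ≠ 0) i (η n) := by
  have := hP.prob
  rw [ae_all_iff]
  intro n
  let ext : (Fin (n + 1) → S) → ℕ → S := fun y k => y (Fin.ofNat (n + 1) k)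
  let w : (ℕ → S) → ℝ := fun x =>
    (if x 0 = i then 1 else 0) * ∏ k ∈ Finset.range n, K (x k) (x (k + 1))
  have hnull : P (⋃ y ∈ {y : Fin (n + 1) → S | w (ext y) = 0},
      {η | ∀ k ≤ n, η k = ext y k}) = 0 := by
    rw [measure_biUnion_null_iff (Set.to_countable _)]
    intro y hy
    have h := hP.fdd n (ext y)
    rw [show _ * _ = (0 : ℝ) from hy] at h
    exact (measureReal_eq_zero_iff).1 h
  rw [ae_iff]
  refine measure_mono_null (fun η hη => ?_) hnull
  rw [Set.mem_ofPred_eq] at hη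
  have hext : ∀ k ≤ n, η k = ext (fun m => η m) k := fun k hk => by
    simp only [ext, Fin.val_ofNat]
    rw [Nat.mod_eq_of_lt (by omega)]
  refine Set.mem_biUnion (x := fun m : Fin (n + 1) => η m) ?_ hext
  by_contra hw
  apply hη
  rw [Set.mem_ofPred_eq, ← ne_eq, mul_ne_zero_iff, Finset.prod_ne_zero_iff] at hw
  obtain ⟨h0, hK⟩ := hw
  rw [← hext 0 (Nat.zero_le n)] at h0
  have h0 : η 0 = i := by by_contra hc; simp [hc] at h0
  have : ∀ k ≤ n, Relation.ReflTransGen (fun a b => K a b ≠ 0) i (η k) := by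
    intro k
    induction k with
    | zero => intro _; rw [h0]
    | succ k ih =>
      intro hk
      refine (ih (by omega)).tail ?_
      have h := hK k (Finset.mem_range.2 (by omega))
      rwa [← hext k (by omega), ← hext (k + 1) hk] at h
  exact this n le_rfl

lemma HitsAlmostSurely.exists_reachable {S : Type*} [Finite S] [DecidableEq S]
    [MeasurableSpace S] {K : Matrix S S ℝ} {i : S} {B : Set S} (h : HitsAlmostSurely K i B) :
    ∃ j ∈ B, Relation.ReflTransGen (fun a b => K a b ≠ 0) i j := by
  obtain ⟨P, hP, hhit⟩ := h
  have := hP.prob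
  obtain ⟨η, h1, n, hn⟩ := (hP.ae_reachable.and hhit).exists
  exact ⟨η n, hn, h1 n⟩

end Hitting

section InversePositivity

/-- If a substochastic chain can leave `{i | p i}` from everywhere, its restriction to this
set has a positive, strictly superharmonic function. -/
lemma exists_strict_superharmonic {S : Type*} [Fintype S] (p : S → Prop) [DecidablePred p]
    {J : Matrix S S ℝ} (h0 : ∀ i j, p i → 0 ≤ J i j) (h1 : ∀ i, p i → ∑ j, J i j ≤ 1)
    (hr : ∀ i, p i → ∃ j, ¬ p j ∧ Relation.ReflTransGen (fun a b => J a b ≠ 0) i j) :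
    ∃ h : {i // p i} → ℝ, (∀ i, 0 < h i) ∧
      ∀ i : {i // p i}, ∑ j : {i // p i}, J i j * h j < h i := by
  classical
  let T : ({i // p i} → ℝ) → {i // p i} → ℝ := fun f i => ∑ j : {i // p i}, J i j * f j
  let f : ℕ → {i // p i} → ℝ := fun n => T^[n] 1
  have hf0 : f 0 = 1 := rfl
  have hfs : ∀ n i, f (n + 1) i = ∑ j : {i // p i}, J i j * f n j := fun n i => by
    simp only [f, Function.iterate_succ_apply', T]
  have hsplit : ∀ i, ∑ j : {i // p i}, J i j + ∑ j : {i // ¬ p i}, J i j = ∑ j, J i j :=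
    fun i => Fintype.sum_subtype_add_sum_subtype p (J i)
  have hanti : ∀ n i, f (n + 1) i ≤ f n i := by
    intro n
    induction n with
    | zero =>
      intro i
      rw [hfs, hf0]
      have h2 : 0 ≤ ∑ j : {i // ¬ p i}, J i j := Finset.sum_nonneg fun j _ => h0 i j i.2
      have := hsplit i
      have := h1 i i.2
      simp only [Pi.one_apply, mul_one]
      linarith
    | succ n ih =>
      intro i
      rw [hfs (n + 1), hfs n]
      exact Finset.sum_le_sum fun j _ => mul_le_mul_of_nonneg_left (ih j) (h0 i j i.2)
  have hanti' : ∀ i, Antitone fun n => f n i := fun i => antitone_nat_of_succ_le fun n => hanti n i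
  have hle1 : ∀ n i, f n i ≤ 1 := fun n i => hanti' i (Nat.zero_le n)
  have hlt : ∀ i : {i // p i}, ∃ n, f n i < 1 := by
    rintro ⟨i, hi⟩
    obtain ⟨j, hj, hij⟩ := hr i hi
    induction hij using Relation.ReflTransGen.head_induction_on with
    | refl => exact absurd hi hj
    | @head a c hac _ ih =>
      have hpos : 0 < J a c := lt_of_le_of_ne (h0 a c hi) (Ne.symm hac)
      have hA : ∑ j : {i // p i}, J a j ≤ 1 := by
        have h2 : 0 ≤ ∑ j : {i // ¬ p i}, J a j := Finset.sum_nonneg fun j _ => h0 a j hi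
        have := hsplit a
        have := h1 a hi
        linarith
      by_cases hc : p c
      · obtain ⟨n, hn⟩ := ih hc
        refine ⟨n + 1, ?_⟩
        rw [hfs]
        refine lt_of_lt_of_le (Finset.sum_lt_sum (g := fun j : {i // p i} => J a j)
          (fun j _ => ?_) ⟨⟨c, hc⟩, Finset.mem_univ _, ?_⟩) hA
        · exact mul_le_of_le_one_right (h0 a j hi) (hle1 n j)
        · exact mul_lt_of_lt_one_right hpos hn
      · refine ⟨1, ?_⟩
        rw [hfs, hf0]
        have h2 : 0 < ∑ j : {i // ¬ p i}, J a j :=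
          Finset.sum_pos' (fun j _ => h0 a j hi) ⟨⟨c, hc⟩, Finset.mem_univ _, hpos⟩
        have := hsplit a
        have := h1 a hi
        simp only [Pi.one_apply, mul_one]
        linarith
  choose n hn using hlt
  let N := Finset.univ.sup n
  have hN : ∀ i, f (N + 1) i < 1 := fun i =>
    lt_of_le_of_lt (hanti' i ((Finset.le_sup (Finset.mem_univ i)).trans (Nat.le_succ N))) (hn i)
  have hfnn : ∀ n i, 0 ≤ f n i := by
    intro n
    induction n with
    | zero => intro i; rw [hf0]; exact zero_le_one
    | succ n ih =>
      intro i
      rw [hfs]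
      exact Finset.sum_nonneg fun j _ => mul_nonneg (h0 i j i.2) (ih j)
  refine ⟨fun i => ∑ k ∈ Finset.range (N + 1), f k i, fun i => ?_, fun i => ?_⟩
  · refine Finset.sum_pos' (fun k _ => hfnn k i) ⟨0, by simp, ?_⟩
    rw [hf0]; exact zero_lt_one
  · have h2 : ∑ j : {i // p i}, J i j * ∑ k ∈ Finset.range (N + 1), f k j
        = ∑ k ∈ Finset.range (N + 1), f (k + 1) i := by
      simp only [Finset.mul_sum, hfs]
      exact Finset.sum_comm
    have h3 := Finset.sum_range_succ' (fun k => f k i) (N + 1)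
    rw [Finset.sum_range_succ] at h3
    have h4 := hN i
    simp only [hf0, Pi.one_apply] at h3
    rw [h2]
    linarith

variable {A : Type*} [Fintype A]

lemma nonneg_of_superharmonic {K : Matrix A A ℝ} (hK : ∀ i j, 0 ≤ K i j) {h : A → ℝ}
    (hpos : ∀ i, 0 < h i) (hh : ∀ i, ∑ j, K i j * h j < h i) {f : A → ℝ}
    (hf : ∀ i, ∑ j, K i j * f j ≤ f i) (i : A) : 0 ≤ f i := by
  by_contra! hi
  obtain ⟨m, -, hm⟩ := Finset.exists_min_image Finset.univ (fun j => f j / h j)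
    ⟨i, Finset.mem_univ i⟩
  set c := f m / h m with hc
  have hc0 : c < 0 := lt_of_le_of_lt (hm i (Finset.mem_univ i)) (div_neg_of_neg_of_pos hi (hpos i))
  have hge : ∀ j, c * h j ≤ f j := fun j => (le_div_iff₀ (hpos j)).1 (hm j (Finset.mem_univ j))
  have h1 : c * ∑ j, K m j * h j ≤ ∑ j, K m j * f j := by
    rw [Finset.mul_sum]
    refine Finset.sum_le_sum fun j _ => ?_
    have := mul_le_mul_of_nonneg_left (hge j) (hK m j)
    linarith
  have h2 : c * h m = f m := div_mul_cancel₀ _ (hpos m).ne'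
  have h3 := mul_lt_mul_of_neg_left (hh m) hc0
  linarith [hf m]

variable [DecidableEq A]

lemma one_sub_mulVec_apply (K : Matrix A A ℝ) (f : A → ℝ) (i : A) :
    ((1 - K).mulVec f) i = f i - ∑ j, K i j * f j := by
  rw [Matrix.sub_mulVec, Matrix.one_mulVec]
  rfl

lemma det_one_sub_ne_zero {K : Matrix A A ℝ} (hK : ∀ i j, 0 ≤ K i j) {h : A → ℝ}
    (hpos : ∀ i, 0 < h i) (hh : ∀ i, ∑ j, K i j * h j < h i) : (1 - K).det ≠ 0 := by
  intro hd
  obtain ⟨v, hv, hv0⟩ := Matrix.exists_mulVec_eq_zero_iff.2 hd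
  have h1 : ∀ i, v i - ∑ j, K i j * v j = 0 := fun i => by
    rw [← one_sub_mulVec_apply, hv0]; rfl
  apply hv
  ext i
  refine le_antisymm ?_ (nonneg_of_superharmonic hK hpos hh (fun i => by linarith [h1 i]) i)
  have := nonneg_of_superharmonic hK hpos hh (f := fun i => -v i)
    (fun i => by simp only [mul_neg, Finset.sum_neg_distrib]; linarith [h1 i]) i
  simpa using this

lemma inv_one_sub_apply_nonneg {K : Matrix A A ℝ} (hK : ∀ i j, 0 ≤ K i j) {h : A → ℝ}
    (hpos : ∀ i, 0 < h i) (hh : ∀ i, ∑ j, K i j * h j < h i) (i j : A) :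
    0 ≤ (1 - K)⁻¹ i j := by
  have hu : IsUnit (1 - K).det := (det_one_sub_ne_zero hK hpos hh).isUnit
  refine nonneg_of_superharmonic hK hpos hh (f := fun i => (1 - K)⁻¹ i j) (fun i => ?_) i
  have h1 : ((1 - K) * (1 - K)⁻¹) i j = (1 : Matrix A A ℝ) i j := by
    rw [Matrix.mul_nonsing_inv _ hu]
  rw [sub_mul, one_mul, Matrix.sub_apply, Matrix.mul_apply] at h1
  have h2 : 0 ≤ (1 : Matrix A A ℝ) i j := by rw [Matrix.one_apply]; split_ifs <;> norm_num
  linarith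

lemma tendsto_matrix_inv {α : Type*} {l : Filter α} {M : α → Matrix A A ℝ}
    {M₀ : Matrix A A ℝ} (hM : Tendsto M l (𝓝 M₀)) (h0 : M₀.det ≠ 0) :
    Tendsto (fun a => (M a)⁻¹) l (𝓝 M₀⁻¹) := by
  simp only [Matrix.inv_def, Ring.inverse_eq_inv']
  have hd : Tendsto (fun a => (M a).det) l (𝓝 M₀.det) :=
    ((continuous_id.matrix_det).tendsto M₀).comp hM
  have ha : Tendsto (fun a => (M a).adjugate) l (𝓝 M₀.adjugate) :=
    ((continuous_id.matrix_adjugate).tendsto M₀).comp hM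
  exact (hd.inv₀ h0).smul ha

end InversePositivity

section Contraction

variable {B : Type*} [Fintype B] [DecidableEq B]

lemma exp_smul_apply_le_one {M : Matrix B B ℝ} (hM : IsRateMatrix M) {t : ℝ} (ht : 0 ≤ t)
    (i j : B) : NormedSpace.exp (t • M) i j ≤ 1 := by
  rw [← sum_exp_smul_apply hM.row_sum t i]
  exact Finset.single_le_sum (f := fun j => NormedSpace.exp (t • M) i j)
    (fun k _ => exp_smul_apply_nonneg hM.nonneg ht i k) (Finset.mem_univ j)

/-- Doeblin contraction: the transition matrix at time one of an irreducible rate matrix is a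
strict `ℓ¹` contraction on vectors of total mass zero. -/
lemma exists_contraction [Nonempty B] {M : Matrix B B ℝ} (hM : IsRateMatrix M)
    (hirr : RateIrreducible M) :
    ∃ δ : ℝ, 0 < δ ∧ δ ≤ 1 ∧ ∀ v : B → ℝ, ∑ i, v i = 0 →
      ∑ j, |∑ i, v i * NormedSpace.exp M i j| ≤ (1 - δ) * ∑ i, |v i| := by
  obtain ⟨m, -, hm⟩ := Finset.exists_min_image (Finset.univ : Finset (B × B))
    (fun x => NormedSpace.exp M x.1 x.2) Finset.univ_nonempty
  set δ := NormedSpace.exp M m.1 m.2 with hδ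
  have hδ0 : 0 < δ := exp_apply_pos_of_rateIrreducible hM.nonneg hirr _ _
  have hle : ∀ i j, δ ≤ NormedSpace.exp M i j := fun i j => hm (i, j) (Finset.mem_univ _)
  have hδ1 : δ ≤ 1 := by
    have := exp_smul_apply_le_one hM zero_le_one m.1 m.2
    rwa [one_smul] at this
  refine ⟨δ, hδ0, hδ1, fun v hv => ?_⟩
  have h1 : ∀ j, |∑ i, v i * NormedSpace.exp M i j|
      ≤ ∑ i, |v i| * (NormedSpace.exp M i j - δ) := by
    intro j
    have : ∑ i, v i * NormedSpace.exp M i j = ∑ i, v i * (NormedSpace.exp M i j - δ) := by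
      simp only [mul_sub, Finset.sum_sub_distrib, ← Finset.sum_mul, hv]
      ring
    rw [this]
    refine (Finset.abs_sum_le_sum_abs _ _).trans (le_of_eq ?_)
    exact Finset.sum_congr rfl fun i _ => by
      rw [abs_mul, abs_of_nonneg (sub_nonneg.2 (hle i j))]
  refine (Finset.sum_le_sum fun j _ => h1 j).trans ?_
  rw [Finset.sum_comm, Finset.mul_sum]
  refine Finset.sum_le_sum fun i _ => ?_
  rw [← Finset.mul_sum, mul_comm]
  refine mul_le_mul_of_nonneg_right ?_ (abs_nonneg _)
  have hs := sum_exp_smul_apply hM.row_sum 1 i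
  rw [one_smul] at hs
  rw [Finset.sum_sub_distrib, hs]
  have : δ ≤ ∑ _j : B, δ :=
    Finset.single_le_sum (f := fun _ : B => δ) (fun _ _ => hδ0.le) (Finset.mem_univ i)
  linarith

lemma sum_abs_sub_flow_le {M : Matrix B B ℝ} (hM : IsRateMatrix M) {w r : ℝ → B → ℝ}
    (hw : ∀ s i, HasDerivAt (fun u => w u i) (∑ k, w s k * M k i + r s i) s) {ρ : ℝ}
    (hr : ∀ s, 0 ≤ s → ∑ i, |r s i| ≤ ρ) {s t : ℝ} (hs : 0 ≤ s) (hst : s ≤ t) :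
    ∑ j, |w t j - ∑ i, w s i * NormedSpace.exp ((t - s) • M) i j|
      ≤ Fintype.card B * (ρ * (t - s)) := by
  have h1 : ∀ j, |w t j - ∑ i, w s i * NormedSpace.exp ((t - s) • M) i j| ≤ ρ * (t - s) := by
    intro j
    have h := norm_image_sub_le_of_norm_deriv_le_segment' (a := s) (b := t) (C := ρ)
      (f := fun u => ∑ i, w u i * NormedSpace.exp ((t - u) • M) i j)
      (fun x _ => (hasDerivAt_sum_mul_exp (hw x) t j).hasDerivWithinAt) (fun x hx => ?_) t
      (Set.right_mem_Icc.2 hst)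
    · simpa [exp_zero_smul, Matrix.one_apply] using h
    · refine (norm_sum_le _ _).trans ((Finset.sum_le_sum fun i _ => ?_).trans
        (hr x (hs.trans hx.1)))
      have htx : 0 ≤ t - x := by linarith [hx.2]
      rw [norm_mul, Real.norm_eq_abs, Real.norm_eq_abs,
        abs_of_nonneg (exp_smul_apply_nonneg hM.nonneg htx i j)]
      exact mul_le_of_le_one_right (abs_nonneg _) (exp_smul_apply_le_one hM htx i j)
  refine (Finset.sum_le_sum fun j _ => h1 j).trans (le_of_eq ?_)
  simp

/-- A perturbation of size `ρ` of an exponentially ergodic linear flow has an effect of order `ρ`,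
uniformly in time. -/
lemma sum_abs_le_of_perturbation {M : Matrix B B ℝ} (hM : IsRateMatrix M) {δ : ℝ}
    (hδ : 0 < δ) (hδ1 : δ ≤ 1)
    (hcontr : ∀ v : B → ℝ, ∑ i, v i = 0 →
      ∑ j, |∑ i, v i * NormedSpace.exp M i j| ≤ (1 - δ) * ∑ i, |v i|)
    {w r : ℝ → B → ℝ}
    (hw : ∀ s i, HasDerivAt (fun u => w u i) (∑ k, w s k * M k i + r s i) s)
    (hw0 : ∀ i, w 0 i = 0) (hsum : ∀ s, 0 ≤ s → ∑ i, w s i = 0) {ρ : ℝ}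
    (hr : ∀ s, 0 ≤ s → ∑ i, |r s i| ≤ ρ) {t : ℝ} (ht : 0 ≤ t) :
    ∑ j, |w t j| ≤ Fintype.card B * ρ / δ := by
  have hρ : 0 ≤ ρ := (Finset.sum_nonneg fun i _ => abs_nonneg _).trans (hr 0 le_rfl)
  have hC : 0 ≤ Fintype.card B * ρ := mul_nonneg (Nat.cast_nonneg _) hρ
  have key : ∀ n : ℕ, ∀ t : ℝ, 0 ≤ t → t ≤ n + 1 → ∑ j, |w t j| ≤ Fintype.card B * ρ / δ := by
    intro n
    induction n with
    | zero =>
      intro t ht ht1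
      have h := sum_abs_sub_flow_le hM hw hr le_rfl ht
      simp only [hw0, zero_mul, Finset.sum_const_zero, sub_zero] at h
      refine h.trans ((?_ : _ ≤ Fintype.card B * ρ).trans (le_div_self hC hδ hδ1))
      rw [← mul_assoc]
      exact mul_le_of_le_one_right hC (by simpa using ht1)
    | succ n ih =>
      intro t ht ht1
      by_cases hle : t ≤ n + 1
      · exact ih t ht hle
      push Not at hle
      have hn : (0 : ℝ) ≤ n := Nat.cast_nonneg n
      have ht' : 0 ≤ t - 1 := by linarith
      push_cast at ht1
      have h1 := sum_abs_sub_flow_le hM hw hr ht' (by linarith : t - 1 ≤ t)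
      rw [sub_sub_cancel, one_smul, mul_one] at h1
      have h2 := hcontr (w (t - 1)) (hsum _ ht')
      have h3 := mul_le_mul_of_nonneg_left (ih (t - 1) ht' (by linarith)) (sub_nonneg.2 hδ1)
      have h4 : ∑ j, |w t j| ≤ ∑ j, |w t j - ∑ i, w (t - 1) i * NormedSpace.exp M i j|
          + ∑ j, |∑ i, w (t - 1) i * NormedSpace.exp M i j| := by
        rw [← Finset.sum_add_distrib]
        refine Finset.sum_le_sum fun j _ => ?_
        have := abs_add_le (w t j - ∑ i, w (t - 1) i * NormedSpace.exp M i j)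
          (∑ i, w (t - 1) i * NormedSpace.exp M i j)
        rwa [sub_add_cancel] at this
      have h5 : Fintype.card B * ρ + (1 - δ) * (Fintype.card B * ρ / δ)
          = Fintype.card B * ρ / δ := by field_simp; ring
      linarith
  obtain ⟨n, hn⟩ := exists_nat_ge t
  exact key n t ht (by linarith)

end Contraction

/-- Comparison principle for a linear flow with bounded input. -/
lemma le_of_bounded_input {A : Type*} [Fintype A] [DecidableEq A] {M : Matrix A A ℝ}
    (hM : ∀ i j, i ≠ j → 0 ≤ M i j) {p b : ℝ → A → ℝ} {m β : A → ℝ}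
    (hp : ∀ s i, HasDerivAt (fun u => p u i) (∑ k, p s k * M k i + b s i) s)
    (hp0 : ∀ i, p 0 i = 0) (hb : ∀ s, 0 ≤ s → ∀ i, b s i ≤ β i) (hm : ∀ i, 0 ≤ m i)
    (hmM : ∀ i, ∑ k, m k * M k i = -β i) {t : ℝ} (ht : 0 ≤ t) (i : A) : p t i ≤ m i := by
  have hv : ∀ s i, HasDerivAt (fun u => m i - p u i)
      (∑ k, (m k - p s k) * M k i + (β i - b s i)) s := fun s i => by
    refine ((hp s i).const_sub (m i)).congr_deriv ?_
    simp only [sub_mul, Finset.sum_sub_distrib, hmM]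
    ring
  have hd : ∀ s, HasDerivAt (fun u => ∑ k, (m k - p u k) * NormedSpace.exp ((t - u) • M) k i)
      (∑ k, (β k - b s k) * NormedSpace.exp ((t - s) • M) k i) s := fun s =>
    hasDerivAt_sum_mul_exp (v := fun u k => m k - p u k) (r := fun k => β k - b s k) (hv s) t i
  have hmono : MonotoneOn (fun u => ∑ k, (m k - p u k) * NormedSpace.exp ((t - u) • M) k i)
      (Set.Icc 0 t) := by
    refine monotoneOn_of_deriv_nonneg (convex_Icc 0 t)
      (fun s _ => (hd s).continuousAt.continuousWithinAt)
      (fun s _ => (hd s).differentiableAt.differentiableWithinAt) fun s hs => ?_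
    rw [interior_Icc] at hs
    rw [(hd s).deriv]
    exact Finset.sum_nonneg fun k _ => mul_nonneg (sub_nonneg.2 (hb s hs.1.le k))
      (exp_smul_apply_nonneg hM (sub_nonneg.2 hs.2.le) k i)
  have h := hmono (Set.left_mem_Icc.2 ht) (Set.right_mem_Icc.2 ht) ht
  simp only [hp0, sub_zero, sub_self, exp_zero_smul] at h
  have h2 : 0 ≤ ∑ k, m k * NormedSpace.exp (t • M) k i :=
    Finset.sum_nonneg fun k _ => mul_nonneg (hm k) (exp_smul_apply_nonneg hM ht k i)
  have h3 : ∑ k, (m k - p t k) * (1 : Matrix A A ℝ) k i = m i - p t i := by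
    simp [Matrix.one_apply]
  rw [h3] at h
  linarith

/-- Nonasymptotic comparison of a chain on `A ⊔ B`, given in block form, with a chain on `B`. Here
`N` is the Green matrix of the chain killed on leaving `A`, and `H` the hitting distribution
of `B` from `A`. -/
theorem block_estimate {A B : Type*} [Fintype A] [DecidableEq A] [Fintype B] [DecidableEq B]
    {QAA N : Matrix A A ℝ} {QAB H : Matrix A B ℝ} {QBA : Matrix B A ℝ} {QBB Γ : Matrix B B ℝ}
    {pA : ℝ → A → ℝ} {pB y : ℝ → B → ℝ}
    (hpB : ∀ s j, HasDerivAt (fun u => pB u j)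
      (∑ k, pB s k * QBB k j + ∑ a, pA s a * QAB a j) s)
    (hpA : ∀ s j, HasDerivAt (fun u => pA u j)
      (∑ a, pA s a * QAA a j + ∑ k, pB s k * QBA k j) s)
    (hpB0 : ∀ s, 0 ≤ s → ∀ j, 0 ≤ pB s j) (hpA0 : ∀ s, 0 ≤ s → ∀ j, 0 ≤ pA s j)
    (hsum : ∀ s, 0 ≤ s → ∑ a, pA s a + ∑ b, pB s b = 1) (hinit : ∀ a, pA 0 a = 0)
    (hQAA : ∀ i j, i ≠ j → 0 ≤ QAA i j) (hQBA : ∀ i j, 0 ≤ QBA i j)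
    (hN : ∀ i j, 0 ≤ N i j) (hNQ : N * QAA = -1)
    (hH : ∀ i j, 0 ≤ H i j) (hH1 : ∀ i, ∑ j, H i j = 1) (hQH : QAA * H = -QAB)
    (hΓ : IsRateMatrix Γ) {δ : ℝ} (hδ : 0 < δ) (hδ1 : δ ≤ 1)
    (hcontr : ∀ v : B → ℝ, ∑ i, v i = 0 →
      ∑ j, |∑ i, v i * NormedSpace.exp Γ i j| ≤ (1 - δ) * ∑ i, |v i|)
    (hy : ∀ s j, HasDerivAt (fun u => y u j) (∑ k, y s k * Γ k j) s)
    (hy0 : ∀ j, y 0 j = pB 0 j) (hy1 : ∀ s, 0 ≤ s → ∑ j, y s j = 1)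
    {α κ : ℝ} (hα : α = ∑ a, ∑ k, (∑ b, QBA b k) * N k a)
    (hκ : κ = ∑ j, ∑ i, (|(QBB + QBA * H) i j - Γ i j| + α * |(QBB + QBA * H) i j|))
    {t : ℝ} (ht : 0 ≤ t) :
    ∑ a, |pA t a| + ∑ b, |pB t b - y t b| ≤ 2 * α + Fintype.card B * κ / δ := by
  set Γ' := QBB + QBA * H with hΓ'
  have hpB1 : ∀ s, 0 ≤ s → ∀ j, pB s j ≤ 1 := fun s hs j => by
    have h1 := Finset.single_le_sum (f := pB s) (fun k _ => hpB0 s hs k) (Finset.mem_univ j)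
    have h2 : 0 ≤ ∑ a, pA s a := Finset.sum_nonneg fun a _ => hpA0 s hs a
    linarith [hsum s hs]
  -- the mass on `A` is uniformly small
  have hmass : ∀ s, 0 ≤ s → ∑ a, pA s a ≤ α := by
    intro s hs
    rw [hα]
    refine Finset.sum_le_sum fun a _ => ?_
    refine le_of_bounded_input (β := fun a => ∑ b, QBA b a)
      (m := fun a => ∑ k, (∑ b, QBA b k) * N k a) hQAA hpA hinit (fun s hs i => ?_)
      (fun i => ?_) (fun i => ?_) hs a
    · exact Finset.sum_le_sum fun k _ => mul_le_of_le_one_left (hQBA k i) (hpB1 s hs k)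
    · exact Finset.sum_nonneg fun k _ =>
        mul_nonneg (Finset.sum_nonneg fun b _ => hQBA b k) (hN k i)
    · have h1 : ∀ l, ∑ k, N l k * QAA k i = -(1 : Matrix A A ℝ) l i := fun l => by
        rw [← Matrix.mul_apply, hNQ]; rfl
      simp only [Finset.sum_mul]
      rw [Finset.sum_comm]
      simp only [mul_assoc, ← Finset.mul_sum, ← Finset.sum_mul]
      simp only [h1, Matrix.one_apply]
      simp
  -- the auxiliary flow
  set g : ℝ → B → ℝ := fun s j => ∑ a, pA s a * H a j with hg
  have hg0 : ∀ s, 0 ≤ s → ∀ j, 0 ≤ g s j := fun s hs j =>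
    Finset.sum_nonneg fun a _ => mul_nonneg (hpA0 s hs a) (hH a j)
  have hgsum : ∀ s, ∑ j, g s j = ∑ a, pA s a := fun s => by
    simp only [hg]
    rw [Finset.sum_comm]
    simp only [← Finset.mul_sum, hH1, mul_one]
  have hgα : ∀ s, 0 ≤ s → ∀ j, g s j ≤ α := fun s hs j =>
    (Finset.single_le_sum (f := g s) (fun k _ => hg0 s hs k) (Finset.mem_univ j)).trans
      ((hgsum s).trans_le (hmass s hs))
  have hz : ∀ s j, HasDerivAt (fun u => pB u j + g u j) (∑ k, pB s k * Γ' k j) s := by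
    intro s j
    have h1 : HasDerivAt (fun u => g u j)
        (∑ a, (∑ k, pA s k * QAA k a + ∑ k, pB s k * QBA k a) * H a j) s :=
      HasDerivAt.fun_sum fun a _ => (hpA s a).mul_const (H a j)
    refine ((hpB s j).add h1).congr_deriv ?_
    have h2 : ∀ l, ∑ k, QAA l k * H k j = -QAB l j := fun l => by
      rw [← Matrix.mul_apply, hQH]; rfl
    have h3 : ∑ a, (∑ k, pA s k * QAA k a) * H a j = -∑ a, pA s a * QAB a j := by
      simp only [Finset.sum_mul]
      rw [Finset.sum_comm]
      simp only [mul_assoc, ← Finset.mul_sum, h2, mul_neg, Finset.sum_neg_distrib]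
    have h4 : ∑ a, (∑ k, pB s k * QBA k a) * H a j = ∑ k, pB s k * (QBA * H) k j := by
      simp only [Finset.sum_mul, Matrix.mul_apply, Finset.mul_sum]
      rw [Finset.sum_comm]
      simp only [mul_assoc]
    simp only [add_mul, Finset.sum_add_distrib, h3, h4, hΓ', Matrix.add_apply, mul_add]
    ring
  have hz1 : ∀ s, 0 ≤ s → ∑ j, (pB s j + g s j) = 1 := fun s hs => by
    rw [Finset.sum_add_distrib, hgsum, ← hsum s hs, add_comm]
  have hzle : ∀ s, 0 ≤ s → ∀ j, |pB s j + g s j| ≤ 1 := fun s hs j => by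
    have h0 : ∀ k, 0 ≤ pB s k + g s k := fun k => add_nonneg (hpB0 s hs k) (hg0 s hs k)
    rw [abs_of_nonneg (h0 j), ← hz1 s hs]
    exact Finset.single_le_sum (f := fun k => pB s k + g s k) (fun k _ => h0 k)
      (Finset.mem_univ j)
  have hwbound := sum_abs_le_of_perturbation hΓ hδ hδ1 hcontr
    (w := fun s j => pB s j + g s j - y s j)
    (r := fun s j => ∑ k, ((pB s k + g s k) * (Γ' k j - Γ k j) - g s k * Γ' k j))
    (ρ := κ) (fun s j => ?_) (fun j => ?_) (fun s hs => ?_) (fun s hs => ?_) ht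
  · have h1 : ∑ b, |pB t b - y t b| ≤ ∑ b, |pB t b + g t b - y t b| + ∑ b, g t b := by
      rw [← Finset.sum_add_distrib]
      refine Finset.sum_le_sum fun b _ => ?_
      have := abs_sub (pB t b + g t b - y t b) (g t b)
      rw [abs_of_nonneg (hg0 t ht b)] at this
      rw [add_sub_right_comm, add_sub_cancel_right] at this
      rwa [add_sub_right_comm]
    have h2 : ∑ a, |pA t a| = ∑ a, pA t a :=
      Finset.sum_congr rfl fun a _ => abs_of_nonneg (hpA0 t ht a)
    have h3 := hmass t ht
    have h4 := hgsum t
    linarith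
  · refine ((hz s j).sub (hy s j)).congr_deriv ?_
    rw [← Finset.sum_sub_distrib, ← Finset.sum_add_distrib]
    exact Finset.sum_congr rfl fun k _ => by ring
  · simp [hg, hinit, hy0]
  · rw [Finset.sum_sub_distrib, hz1 s hs, hy1 s hs, sub_self]
  · rw [hκ]
    refine Finset.sum_le_sum fun j _ => (Finset.abs_sum_le_sum_abs _ _).trans
      (Finset.sum_le_sum fun k _ => (abs_sub _ _).trans (add_le_add ?_ ?_))
    · rw [abs_mul]
      exact mul_le_of_le_one_left (abs_nonneg _) (hzle s hs k)
    · rw [abs_mul, abs_of_nonneg (hg0 s hs k)]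
      exact mul_le_mul_of_nonneg_right (hgα s hs k) (abs_nonneg _)

/-- The law of a continuous-time chain at time `t`. -/
lemma IsMarkovChain.real_preimage_singleton {S Ω : Type*} [Fintype S] [DecidableEq S]
    [MeasurableSpace S] [MeasurableSingletonClass S] [MeasurableSpace Ω] {P : Measure Ω}
    {M : Matrix S S ℝ} {init : S → ℝ} {X : ℝ≥0 → Ω → S} (hX : IsMarkovChain P M init X)
    (t : ℝ≥0) (j : S) :
    P.real (X t ⁻¹' {j}) = ∑ i, init i * NormedSpace.exp ((t : ℝ) • M) i j := by
  have := hX.prob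
  have hcyl : ∀ i, P.real (X 0 ⁻¹' {i} ∩ X t ⁻¹' {j})
      = init i * NormedSpace.exp ((t : ℝ) • M) i j := by
    intro i
    have h := hX.fdd 1 (fun k => if k = 0 then 0 else t) (fun k => if k = 0 then i else j) rfl
      (fun a b hab => by
        rcases Nat.eq_zero_or_pos a with rfl | ha
        · simp
        · simp [ha.ne', (ha.trans_le hab).ne'])
    have hset : X 0 ⁻¹' {i} ∩ X t ⁻¹' {j} = {ω | ∀ k ≤ 1,
        X (if k = 0 then 0 else t) ω = if k = 0 then i else j} := by
      ext ω
      simp [Nat.le_one_iff_eq_zero_or_eq_one]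
    rw [hset, h]
    simp
  rw [← Finset.sum_congr rfl fun i _ => hcyl i]
  have hunion : X t ⁻¹' {j} = ⋃ i ∈ (Finset.univ : Finset S), X 0 ⁻¹' {i} ∩ X t ⁻¹' {j} := by
    ext ω
    simp
  conv_lhs => rw [hunion]
  refine measureReal_biUnion_finset (fun a _ b _ hab => ?_) fun i _ =>
    (hX.measurable 0 (measurableSet_singleton i)).inter
      (hX.measurable t (measurableSet_singleton j))
  exact Set.disjoint_left.2 fun ω h1 h2 => hab (h1.1.symm.trans h2.1)

section Elementary

variable {S : Type*} [Fintype S] [DecidableEq S] {M : Matrix S S ℝ}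

lemma IsRateMatrix.exitRate_eq (hM : IsRateMatrix M) (i : S) :
    exitRate M i = ∑ j ∈ Finset.univ.erase i, M i j := by
  have h := Finset.add_sum_erase Finset.univ (fun j => M i j) (Finset.mem_univ i)
  have h' := hM.row_sum i
  simp only [exitRate]
  linarith

lemma IsRateMatrix.le_exitRate (hM : IsRateMatrix M) {i j : S} (hij : i ≠ j) :
    M i j ≤ exitRate M i := by
  rw [hM.exitRate_eq]
  exact Finset.single_le_sum (f := fun j => M i j)
    (fun k hk => hM.nonneg i k (Finset.ne_of_mem_erase hk).symm)
    (Finset.mem_erase.2 ⟨hij.symm, Finset.mem_univ j⟩)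

lemma IsRateMatrix.exitRate_nonneg (hM : IsRateMatrix M) (i : S) : 0 ≤ exitRate M i := by
  rw [hM.exitRate_eq]
  exact Finset.sum_nonneg fun k hk => hM.nonneg i k (Finset.ne_of_mem_erase hk).symm

lemma IsRateMatrix.jumpMatrix_nonneg (hM : IsRateMatrix M) (i j : S) :
    0 ≤ jumpMatrix M i j := by
  simp only [jumpMatrix, Matrix.of_apply]
  split_ifs with h
  · exact le_rfl
  · exact div_nonneg (hM.nonneg i j h) (hM.exitRate_nonneg i)

lemma exitRate_mul_jumpMatrix {T : Type*} [DecidableEq T] {M : Matrix T T ℝ} {i : T}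
    (hi : exitRate M i ≠ 0) (j : T) :
    exitRate M i * (jumpMatrix M i j - (1 : Matrix T T ℝ) i j) = M i j := by
  simp only [jumpMatrix, Matrix.of_apply]
  rcases eq_or_ne i j with rfl | h
  · simp [exitRate]
  · rw [if_neg h, Matrix.one_apply_ne h, sub_zero, mul_div_cancel₀ _ hi]

lemma IsRateMatrix.sum_jumpMatrix (hM : IsRateMatrix M) {i : S} (hi : exitRate M i ≠ 0) :
    ∑ j, jumpMatrix M i j = 1 := by
  have h : exitRate M i * (∑ j, jumpMatrix M i j - 1) = 0 := by
    have h1 : ∑ j, (1 : Matrix S S ℝ) i j = 1 := by simp [Matrix.one_apply]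
    rw [← hM.row_sum i, ← h1, ← Finset.sum_sub_distrib, Finset.mul_sum]
    exact Finset.sum_congr rfl fun j _ => exitRate_mul_jumpMatrix hi j
  have := (mul_eq_zero.1 h).resolve_left hi
  linarith

end Elementary

/-- Hitting distributions are probability distributions. -/
lemma sum_inv_one_sub_mul_apply {A B : Type*} [Fintype A] [DecidableEq A] [Fintype B]
    {K : Matrix A A ℝ} {R : Matrix A B ℝ} (hK : (1 - K).det ≠ 0)
    (hrow : ∀ i, ∑ j, K i j + ∑ j, R i j = 1) (i : A) :
    ∑ j, ((1 - K)⁻¹ * R) i j = 1 := by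
  have h1 : R.mulVec 1 = (1 - K).mulVec 1 := by
    ext a
    rw [one_sub_mulVec_apply, Pi.one_apply, ← hrow a]
    simp [Matrix.mulVec, dotProduct]
  have h2 : ((1 - K)⁻¹ * R).mulVec 1 = 1 := by
    rw [← Matrix.mulVec_mulVec, h1, Matrix.mulVec_mulVec, Matrix.nonsing_inv_mul _ hK.isUnit,
      Matrix.one_mulVec]
  have h3 := congrFun h2 i
  simpa [Matrix.mulVec, dotProduct] using h3

namespace IsTwoTimeScale

variable {S : Type*} [Fintype S] [DecidableEq S] [MeasurableSpace S] {Q : ℝ → Matrix S S ℝ}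

lemma isFast_or_isSlow (hQ : IsTwoTimeScale Q) (i : S) : IsFast Q i ∨ IsSlow Q i := by
  by_cases h : ∃ j, i ≠ j ∧ Tendsto (fun l => Q l i j) atTop atTop
  · obtain ⟨j, hij, hj⟩ := h
    left
    refine tendsto_atTop_mono' _ ?_ hj
    filter_upwards [eventually_gt_atTop 0] with l hl
    exact (hQ.rateMatrix l hl).le_exitRate hij
  · right
    have h' : ∀ j, ∃ c : ℝ, i ≠ j → Tendsto (fun l => Q l i j) atTop (𝓝 c) := fun j => by
      by_cases hij : i = j
      · exact ⟨0, fun h => absurd hij h⟩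
      · obtain ⟨c, hc⟩ := (hQ.rate_limit i j hij).resolve_right fun hh => h ⟨j, hij, hh⟩
        exact ⟨c, fun _ => hc⟩
    choose c hc using h'
    refine ⟨∑ j ∈ Finset.univ.erase i, c j, ?_⟩
    refine (tendsto_finsetSum (Finset.univ.erase i)
      fun j hj => hc j (Finset.ne_of_mem_erase hj).symm).congr' ?_
    filter_upwards [eventually_gt_atTop 0] with l hl
    rw [(hQ.rateMatrix l hl).exitRate_eq]

lemma isFast_iff_not_isSlow (hQ : IsTwoTimeScale Q) (i : S) : IsFast Q i ↔ ¬ IsSlow Q i :=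
  ⟨fun h ⟨c, hc⟩ => not_tendsto_nhds_of_tendsto_atTop h c hc,
    fun h => (hQ.isFast_or_isSlow i).resolve_right h⟩

lemma sum_eq (hQ : IsTwoTimeScale Q) (f : S → ℝ) :
    ∑ s, f s = ∑ a : Fast Q, f a + ∑ b : Slow Q, f b := by
  rw [← Fintype.sum_subtype_add_sum_subtype (IsSlow Q) f, add_comm]
  congr 1
  exact Fintype.sum_equiv (Equiv.subtypeEquivRight fun i => (hQ.isFast_iff_not_isSlow i).symm)
    _ _ fun _ => rfl

lemma tendsto_limRate (hQ : IsTwoTimeScale Q) {i : S} (hi : IsSlow Q i) (j : S) :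
    Tendsto (fun l => Q l i j) atTop (𝓝 (limRate Q i j)) := by
  suffices h : ∃ c, Tendsto (fun l => Q l i j) atTop (𝓝 c) from tendsto_nhds_limUnder h
  obtain ⟨c, hc⟩ := hi
  rcases eq_or_ne i j with rfl | hij
  · exact ⟨-c, by simpa [exitRate] using hc.neg⟩
  · refine (hQ.rate_limit i j hij).resolve_right fun h => ?_
    refine not_tendsto_nhds_of_tendsto_atTop (tendsto_atTop_mono' _ ?_ h) c hc
    filter_upwards [eventually_gt_atTop 0] with l hl
    exact (hQ.rateMatrix l hl).le_exitRate hij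

lemma tendsto_limJump (hQ : IsTwoTimeScale Q) (i j : S) :
    Tendsto (fun l => jumpMatrix (Q l) i j) atTop (𝓝 (limJump Q i j)) := by
  suffices h : ∃ c, Tendsto (fun l => jumpMatrix (Q l) i j) atTop (𝓝 c) from
    tendsto_nhds_limUnder h
  rcases eq_or_ne i j with rfl | hij
  · exact ⟨0, by simp [jumpMatrix]⟩
  · exact hQ.jump_limit i j hij

lemma limJump_nonneg (hQ : IsTwoTimeScale Q) (i j : S) : 0 ≤ limJump Q i j := by
  refine ge_of_tendsto (hQ.tendsto_limJump i j) ?_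
  filter_upwards [eventually_gt_atTop 0] with l hl
  exact (hQ.rateMatrix l hl).jumpMatrix_nonneg i j

lemma sum_limJump (hQ : IsTwoTimeScale Q) {i : S} (hi : IsFast Q i) :
    ∑ j, limJump Q i j = 1 := by
  refine tendsto_nhds_unique (tendsto_finsetSum _ fun j _ => hQ.tendsto_limJump i j)
    (tendsto_const_nhds.congr' ?_)
  filter_upwards [eventually_gt_atTop 0, hi.eventually_gt_atTop 0] with l hl hpos
  exact ((hQ.rateMatrix l hl).sum_jumpMatrix hpos.ne').symm

lemma exists_superharmonic (hQ : IsTwoTimeScale Q) :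
    ∃ h : Fast Q → ℝ, (∀ i, 0 < h i) ∧ ∀ i : Fast Q, ∑ j : Fast Q, limJump Q i j * h j < h i := by
  refine exists_strict_superharmonic (IsFast Q) (fun i j _ => hQ.limJump_nonneg i j)
    (fun i hi => (hQ.sum_limJump hi).le) fun i hi => ?_
  obtain ⟨j, hj, hij⟩ := (hQ.hits_slow i hi).exists_reachable
  exact ⟨j, fun h => (hQ.isFast_iff_not_isSlow j).1 h hj, hij⟩

end IsTwoTimeScale

section Blocks

variable {S : Type*} [Fintype S] [DecidableEq S] (Q : ℝ → Matrix S S ℝ)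

/-- The jump matrix at parameter `l`, restricted to the fast states. -/
noncomputable def fastJump (l : ℝ) : Matrix (Fast Q) (Fast Q) ℝ :=
  (jumpMatrix (Q l)).submatrix (↑) (↑)

/-- The jump matrix at parameter `l` from fast to slow states. -/
noncomputable def exitJump (l : ℝ) : Matrix (Fast Q) (Slow Q) ℝ :=
  (jumpMatrix (Q l)).submatrix (↑) (↑)

/-- The hitting distributions of the slow states from the fast ones, at parameter `l`. -/
noncomputable def hittingMatrix (l : ℝ) : Matrix (Fast Q) (Slow Q) ℝ :=
  (1 - fastJump Q l)⁻¹ * exitJump Q l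

/-- The expected occupation times of the fast states before hitting the slow ones, at
parameter `l`. -/
noncomputable def greenMatrix (l : ℝ) : Matrix (Fast Q) (Fast Q) ℝ :=
  Matrix.of fun i j => (1 - fastJump Q l)⁻¹ i j * (exitRate (Q l) j)⁻¹

/-- The rate matrix, at parameter `l`, of the chain watched on the slow states. -/
noncomputable def watchedRate (l : ℝ) : Matrix (Slow Q) (Slow Q) ℝ :=
  (Q l).submatrix (↑) (↑) +
    (Q l).submatrix (Subtype.val : Slow Q → S) (Subtype.val : Fast Q → S) * hittingMatrix Q l

end Blocks

lemma tendsto_matrix_mul {α m n k : Type*} [Fintype n] {l : Filter α} {M : α → Matrix m n ℝ}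
    {N : α → Matrix n k ℝ} {M₀ : Matrix m n ℝ} {N₀ : Matrix n k ℝ} (hM : Tendsto M l (𝓝 M₀))
    (hN : Tendsto N l (𝓝 N₀)) : Tendsto (fun a => M a * N a) l (𝓝 (M₀ * N₀)) :=
  ((continuous_fst.matrix_mul continuous_snd).tendsto (M₀, N₀)).comp (hM.prodMk_nhds hN)

lemma eventually_exitRate_pos {S : Type*} [Finite S] (Q : ℝ → Matrix S S ℝ) :
    ∀ᶠ l in atTop, ∀ a : Fast Q, 0 < exitRate (Q l) a :=
  eventually_all.2 fun a => a.2.eventually_gt_atTop 0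

namespace IsTwoTimeScale

variable {S : Type*} [Fintype S] [DecidableEq S] [MeasurableSpace S] {Q : ℝ → Matrix S S ℝ}

lemma slow_ne_fast (hQ : IsTwoTimeScale Q) (b : Slow Q) (a : Fast Q) : (b : S) ≠ a :=
  fun h => (hQ.isFast_iff_not_isSlow a).1 a.2 (h ▸ b.2)

lemma tendsto_fastJump (hQ : IsTwoTimeScale Q) :
    Tendsto (fastJump Q) atTop (𝓝 ((limJump Q).submatrix (↑) (↑))) :=
  tendsto_pi_nhds.2 fun i => tendsto_pi_nhds.2 fun j => hQ.tendsto_limJump i j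

lemma tendsto_exitJump (hQ : IsTwoTimeScale Q) :
    Tendsto (exitJump Q) atTop (𝓝 ((limJump Q).submatrix (↑) (↑))) :=
  tendsto_pi_nhds.2 fun i => tendsto_pi_nhds.2 fun j => hQ.tendsto_limJump i j

lemma tendsto_inv_one_sub_fastJump (hQ : IsTwoTimeScale Q) :
    Tendsto (fun l => (1 - fastJump Q l)⁻¹) atTop
      (𝓝 (1 - (limJump Q).submatrix (Subtype.val : Fast Q → S) Subtype.val)⁻¹) := by
  obtain ⟨h, hpos, hh⟩ := hQ.exists_superharmonic
  exact tendsto_matrix_inv (hQ.tendsto_fastJump.const_sub 1)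
    (det_one_sub_ne_zero (fun i j => hQ.limJump_nonneg i j) hpos hh)

lemma tendsto_watchedRate (hQ : IsTwoTimeScale Q) :
    Tendsto (watchedRate Q) atTop (𝓝 (reducedRate Q)) := by
  have h1 : Tendsto (fun l => (Q l).submatrix (Subtype.val : Slow Q → S) (Subtype.val : Slow Q → S))
      atTop (𝓝 ((limRate Q).submatrix (↑) (↑))) :=
    tendsto_pi_nhds.2 fun i => tendsto_pi_nhds.2 fun j => hQ.tendsto_limRate i.2 j
  have h2 : Tendsto (fun l => (Q l).submatrix (Subtype.val : Slow Q → S) (Subtype.val : Fast Q → S))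
      atTop (𝓝 ((limRate Q).submatrix (↑) (↑))) :=
    tendsto_pi_nhds.2 fun i => tendsto_pi_nhds.2 fun j => hQ.tendsto_limRate i.2 j
  have h := h1.add (tendsto_matrix_mul h2
    (tendsto_matrix_mul hQ.tendsto_inv_one_sub_fastJump hQ.tendsto_exitJump))
  rw [← Matrix.mul_assoc] at h
  exact h

lemma tendsto_greenMatrix (hQ : IsTwoTimeScale Q) (i j : Fast Q) :
    Tendsto (fun l => greenMatrix Q l i j) atTop (𝓝 0) := by
  have h1 := tendsto_pi_nhds.1 (tendsto_pi_nhds.1 hQ.tendsto_inv_one_sub_fastJump i) j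
  have h2 := h1.mul (tendsto_inv_atTop_zero.comp j.2)
  rw [mul_zero] at h2
  exact h2

lemma eventually_superharmonic {h : Fast Q → ℝ} (hQ : IsTwoTimeScale Q)
    (hh : ∀ i : Fast Q, ∑ j : Fast Q, limJump Q i j * h j < h i) :
    ∀ᶠ l in atTop, ∀ i, ∑ j, fastJump Q l i j * h j < h i :=
  eventually_all.2 fun i => by
    have ht : Tendsto (fun l => ∑ j, fastJump Q l i j * h j) atTop
        (𝓝 (∑ j : Fast Q, limJump Q i j * h j)) :=
      tendsto_finsetSum _ fun j _ => (hQ.tendsto_limJump i j).mul_const (h j)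
    exact ht.eventually_lt_const (hh i)

/-- The properties of the block matrices that hold once `l` is large. -/
lemma eventually_blocks (hQ : IsTwoTimeScale Q) : ∀ᶠ l in atTop,
    (∀ i j, 0 ≤ greenMatrix Q l i j) ∧
    greenMatrix Q l * (Q l).submatrix (↑) (↑) = -1 ∧
    (∀ i j, 0 ≤ hittingMatrix Q l i j) ∧ (∀ i, ∑ j, hittingMatrix Q l i j = 1) ∧
    (Q l).submatrix (Subtype.val : Fast Q → S) (Subtype.val : Fast Q → S) * hittingMatrix Q l
      = -(Q l).submatrix (↑) (↑) := by
  obtain ⟨h, hpos, hh⟩ := hQ.exists_superharmonic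
  filter_upwards [eventually_gt_atTop 0, eventually_exitRate_pos Q,
    hQ.eventually_superharmonic hh] with l hl hq hhl
  have hR := hQ.rateMatrix l hl
  have hK0 : ∀ i j, 0 ≤ fastJump Q l i j := fun i j => hR.jumpMatrix_nonneg i j
  have hdet := det_one_sub_ne_zero hK0 hpos hhl
  have hG0 := inv_one_sub_apply_nonneg hK0 hpos hhl
  have hone : ∀ i j : Fast Q, (1 : Matrix S S ℝ) i j = (1 : Matrix (Fast Q) (Fast Q) ℝ) i j :=
    fun i j => by simp [Matrix.one_apply, Subtype.ext_iff]
  have hAA : ∀ i j : Fast Q, Q l i j = exitRate (Q l) i * -((1 - fastJump Q l) i j) := fun i j => by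
    rw [← exitRate_mul_jumpMatrix (hq i).ne' (j : S), Matrix.sub_apply, neg_sub, hone]
    rfl
  have hAB : ∀ (i : Fast Q) (j : Slow Q), Q l i j = exitRate (Q l) i * exitJump Q l i j :=
    fun i j => by
      rw [← exitRate_mul_jumpMatrix (hq i).ne' (j : S),
        Matrix.one_apply_ne (hQ.slow_ne_fast j i).symm, sub_zero]
      rfl
  refine ⟨fun i j => mul_nonneg (hG0 i j) (inv_nonneg.2 (hq j).le), ?_, fun i j => ?_, ?_, ?_⟩
  · rw [← Matrix.nonsing_inv_mul _ hdet.isUnit]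
    ext i j
    rw [Matrix.neg_apply, Matrix.mul_apply, Matrix.mul_apply, ← Finset.sum_neg_distrib]
    refine Finset.sum_congr rfl fun k _ => ?_
    rw [Matrix.submatrix_apply, hAA, greenMatrix, Matrix.of_apply, mul_assoc,
      inv_mul_cancel_left₀ (hq k).ne', mul_neg]
  · rw [hittingMatrix, Matrix.mul_apply]
    exact Finset.sum_nonneg fun k _ => mul_nonneg (hG0 i k) (hR.jumpMatrix_nonneg k j)
  · exact sum_inv_one_sub_mul_apply hdet fun i => by
      rw [← hR.sum_jumpMatrix (hq i).ne', hQ.sum_eq]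
      rfl
  · ext i j
    have hcancel : (1 - fastJump Q l) * hittingMatrix Q l = exitJump Q l := by
      rw [hittingMatrix, Matrix.mul_nonsing_inv_cancel_left _ _ hdet.isUnit]
    rw [Matrix.neg_apply, Matrix.submatrix_apply, hAB, ← hcancel, Matrix.mul_apply,
      Matrix.mul_apply, Finset.mul_sum, ← Finset.sum_neg_distrib]
    refine Finset.sum_congr rfl fun k _ => ?_
    rw [Matrix.submatrix_apply, hAA]
    ring

lemma eventually_isRateMatrix_watchedRate (hQ : IsTwoTimeScale Q) :
    ∀ᶠ l in atTop, IsRateMatrix (watchedRate Q l) := by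
  filter_upwards [eventually_gt_atTop 0, hQ.eventually_blocks] with l hl hb
  obtain ⟨-, -, hH, hH1, -⟩ := hb
  have hR := hQ.rateMatrix l hl
  refine ⟨fun i j hij => ?_, fun i => ?_⟩
  · rw [watchedRate, Matrix.add_apply, Matrix.mul_apply]
    exact add_nonneg (hR.nonneg i j fun h => hij (Subtype.ext h))
      (Finset.sum_nonneg fun k _ => mul_nonneg (hR.nonneg i k (hQ.slow_ne_fast i k)) (hH k j))
  · simp only [watchedRate, Matrix.add_apply, Matrix.mul_apply, Finset.sum_add_distrib]
    rw [Finset.sum_comm (f := fun j k => _ * _)]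
    simp only [← Finset.mul_sum, hH1, mul_one, Matrix.submatrix_apply]
    rw [add_comm, ← hQ.sum_eq, hR.row_sum]

lemma isRateMatrix_reducedRate (hQ : IsTwoTimeScale Q) : IsRateMatrix (reducedRate Q) := by
  have ht : ∀ i j, Tendsto (fun l => watchedRate Q l i j) atTop (𝓝 (reducedRate Q i j)) :=
    fun i j => tendsto_pi_nhds.1 (tendsto_pi_nhds.1 hQ.tendsto_watchedRate i) j
  refine ⟨fun i j hij => ge_of_tendsto (ht i j) ?_, fun i => ?_⟩
  · filter_upwards [hQ.eventually_isRateMatrix_watchedRate] with l hl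
    exact hl.nonneg i j hij
  · refine tendsto_nhds_unique (tendsto_finsetSum _ fun j _ => ht i j)
      (tendsto_const_nhds.congr' ?_)
    filter_upwards [hQ.eventually_isRateMatrix_watchedRate] with l hl
    exact (hl.row_sum i).symm

end IsTwoTimeScale

section Flow

variable {S : Type*} [Fintype S] [DecidableEq S]

/-- The distribution at time `t` of a chain with rate matrix `M` and initial distribution `π`. -/
noncomputable def flow (M : Matrix S S ℝ) (π : S → ℝ) (t : ℝ) (j : S) : ℝ :=
  ∑ i, π i * NormedSpace.exp (t • M) i j

variable (M : Matrix S S ℝ) (π : S → ℝ)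

lemma hasDerivAt_flow (t : ℝ) (j : S) :
    HasDerivAt (fun u => flow M π u j) (∑ k, flow M π t k * M k j) t := by
  have h : HasDerivAt (fun u => flow M π u j)
      (∑ i, π i * (NormedSpace.exp (t • M) * M) i j) t :=
    HasDerivAt.fun_sum fun i _ => (hasDerivAt_exp_smul_apply M i j t).const_mul (π i)
  refine h.congr_deriv ?_
  simp only [flow, Matrix.mul_apply, Finset.mul_sum, Finset.sum_mul]
  rw [Finset.sum_comm]
  simp only [mul_assoc]

lemma flow_zero (j : S) : flow M π 0 j = π j := by
  simp only [flow, exp_zero_smul]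
  simp [Matrix.one_apply]

variable {M π}

lemma flow_nonneg (hM : IsRateMatrix M) (hπ : ∀ i, 0 ≤ π i) {t : ℝ} (ht : 0 ≤ t) (j : S) :
    0 ≤ flow M π t j :=
  Finset.sum_nonneg fun i _ => mul_nonneg (hπ i) (exp_smul_apply_nonneg hM.nonneg ht i j)

lemma sum_flow (hM : IsRateMatrix M) (hπ : ∑ i, π i = 1) (t : ℝ) : ∑ j, flow M π t j = 1 := by
  simp only [flow]
  rw [Finset.sum_comm]
  simp only [← Finset.mul_sum, sum_exp_smul_apply hM.row_sum, mul_one, hπ]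

end Flow

section Bounds

variable {S : Type*} [Fintype S] [DecidableEq S] (Q : ℝ → Matrix S S ℝ)

/-- A bound on the mass that the chain with rate matrix `Q l` puts on the fast states. -/
noncomputable def fastMass (l : ℝ) : ℝ :=
  ∑ a : Fast Q, ∑ k : Fast Q, (∑ b : Slow Q, Q l b k) * greenMatrix Q l k a

/-- The size of the perturbation of the reduced chain at parameter `l`. -/
noncomputable def rateDefect (l : ℝ) : ℝ :=
  ∑ j, ∑ i, (|watchedRate Q l i j - reducedRate Q i j| + fastMass Q l * |watchedRate Q l i j|)

end Bounds

namespace IsTwoTimeScale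

variable {S : Type*} [Fintype S] [DecidableEq S] [MeasurableSpace S] {Q : ℝ → Matrix S S ℝ}

lemma tendsto_fastMass (hQ : IsTwoTimeScale Q) : Tendsto (fastMass Q) atTop (𝓝 0) := by
  have h : Tendsto (fastMass Q) atTop
      (𝓝 (∑ _a : Fast Q, ∑ k : Fast Q, (∑ b : Slow Q, limRate Q b k) * 0)) :=
    tendsto_finsetSum _ fun a _ => tendsto_finsetSum _ fun k _ =>
      (tendsto_finsetSum _ fun b _ => hQ.tendsto_limRate b.2 k).mul
        (hQ.tendsto_greenMatrix k a)
  simpa using h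

lemma tendsto_rateDefect (hQ : IsTwoTimeScale Q) : Tendsto (rateDefect Q) atTop (𝓝 0) := by
  have ht : ∀ i j, Tendsto (fun l => watchedRate Q l i j) atTop (𝓝 (reducedRate Q i j)) :=
    fun i j => tendsto_pi_nhds.1 (tendsto_pi_nhds.1 hQ.tendsto_watchedRate i) j
  have h : Tendsto (rateDefect Q) atTop (𝓝 (∑ j, ∑ i,
      (|reducedRate Q i j - reducedRate Q i j| + 0 * |reducedRate Q i j|))) :=
    tendsto_finsetSum _ fun j _ => tendsto_finsetSum _ fun i _ =>
      ((ht i j).sub_const _).abs.add (hQ.tendsto_fastMass.mul (ht i j).abs)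
  simpa using h

/-- Nonasymptotic bound on the `ℓ¹` distance between the distributions at time `t` of the chain
with rate matrix `Q l` and of the reduced chain. -/
lemma eventually_sum_abs_flow_sub_le (hQ : IsTwoTimeScale Q)
    {π : S → ℝ} (hπ : π ∈ stdSimplex ℝ S) (hπB : ∀ i, ¬ IsSlow Q i → π i = 0)
    {δ : ℝ} (hδ : 0 < δ) (hδ1 : δ ≤ 1)
    (hcontr : ∀ v : Slow Q → ℝ, ∑ i, v i = 0 →
      ∑ j, |∑ i, v i * NormedSpace.exp (reducedRate Q) i j| ≤ (1 - δ) * ∑ i, |v i|) :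
    ∀ᶠ l in atTop, ∀ t, 0 ≤ t →
      ∑ a : Fast Q, |flow (Q l) π t a| + ∑ b : Slow Q,
        |flow (Q l) π t b - flow (reducedRate Q) (fun i : Slow Q => π i) t b|
        ≤ 2 * fastMass Q l + Fintype.card (Slow Q) * rateDefect Q l / δ := by
  have hΓ := hQ.isRateMatrix_reducedRate
  have hπA : ∀ a : Fast Q, π a = 0 := fun a => hπB a ((hQ.isFast_iff_not_isSlow a).1 a.2)
  have hπsum : ∑ b : Slow Q, π b = 1 := by
    have h := hQ.sum_eq π
    simp only [hπA, Finset.sum_const_zero, zero_add] at h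
    exact h.symm.trans hπ.2
  filter_upwards [eventually_gt_atTop 0, hQ.eventually_blocks] with l hl hb t ht
  obtain ⟨hN, hNQ, hH, hH1, hQH⟩ := hb
  have hR := hQ.rateMatrix l hl
  have hAA : ∀ i j : Fast Q, i ≠ j →
      0 ≤ (Q l).submatrix (Subtype.val : Fast Q → S) (Subtype.val : Fast Q → S) i j :=
    fun i j hij => hR.nonneg _ _ (Subtype.coe_injective.ne hij)
  have hBA : ∀ (i : Slow Q) (j : Fast Q),
      0 ≤ (Q l).submatrix (Subtype.val : Slow Q → S) (Subtype.val : Fast Q → S) i j :=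
    fun i j => hR.nonneg _ _ (hQ.slow_ne_fast i j)
  have hB' : ∀ (s : ℝ) (j : Slow Q), HasDerivAt (fun u => flow (Q l) π u j)
      (∑ k : Slow Q, flow (Q l) π s k * (Q l).submatrix Subtype.val Subtype.val k j
        + ∑ a : Fast Q, flow (Q l) π s a * (Q l).submatrix Subtype.val Subtype.val a j) s := by
    intro s j
    refine (hasDerivAt_flow (Q l) π s j).congr_deriv ?_
    rw [hQ.sum_eq, add_comm]
    simp only [Matrix.submatrix_apply]
  have hA' : ∀ (s : ℝ) (j : Fast Q), HasDerivAt (fun u => flow (Q l) π u j)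
      (∑ a : Fast Q, flow (Q l) π s a * (Q l).submatrix Subtype.val Subtype.val a j
        + ∑ k : Slow Q, flow (Q l) π s k * (Q l).submatrix Subtype.val Subtype.val k j) s := by
    intro s j
    refine (hasDerivAt_flow (Q l) π s j).congr_deriv ?_
    rw [hQ.sum_eq]
    simp only [Matrix.submatrix_apply]
  have hsum : ∀ s, 0 ≤ s → ∑ a : Fast Q, flow (Q l) π s a + ∑ b : Slow Q, flow (Q l) π s b = 1 :=
    fun s _ => by rw [← hQ.sum_eq, sum_flow hR hπ.2 s]
  have hinit : ∀ a : Fast Q, flow (Q l) π 0 a = 0 := fun a => by rw [flow_zero, hπA]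
  have hy0 : ∀ j : Slow Q, flow (reducedRate Q) (fun i : Slow Q => π i) 0 j = flow (Q l) π 0 j :=
    fun j => by rw [flow_zero, flow_zero]
  exact block_estimate (A := Fast Q) (B := Slow Q)
    (pA := fun s a => flow (Q l) π s a) (pB := fun s b => flow (Q l) π s b)
    (y := flow (reducedRate Q) (fun i : Slow Q => π i)) hB' hA'
    (fun s hs j => flow_nonneg hR hπ.1 hs j) (fun s hs j => flow_nonneg hR hπ.1 hs j) hsum hinit
    hAA hBA hN hNQ hH hH1 hQH hΓ hδ hδ1 hcontr (hasDerivAt_flow (reducedRate Q) _) hy0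
    (fun s _ => sum_flow hΓ hπsum s) (α := fastMass Q l) (κ := rateDefect Q l)
    (by simp only [fastMass, Matrix.submatrix_apply]) (by rw [rateDefect]; rfl) ht

/-- A bound, vanishing as `l → ∞`, on the `ℓ¹` distance between the distributions at time `t` of
the chain with rate matrix `Q l` and of the reduced chain, uniform in `t`. -/
lemma exists_uniform_bound (hQ : IsTwoTimeScale Q) (hirr : RateIrreducible (reducedRate Q))
    {π : S → ℝ} (hπ : π ∈ stdSimplex ℝ S) (hπB : ∀ i, ¬ IsSlow Q i → π i = 0) :
    ∃ F : ℝ → ℝ, Tendsto F atTop (𝓝 0) ∧ ∀ᶠ l in atTop, ∀ t, 0 ≤ t →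
      ∑ a : Fast Q, |flow (Q l) π t a| + ∑ b : Slow Q,
        |flow (Q l) π t b - flow (reducedRate Q) (fun i : Slow Q => π i) t b| ≤ F l := by
  have : Nonempty (Slow Q) := nonempty_subtype.2 hQ.slow_nonempty
  obtain ⟨δ, hδ, hδ1, hcontr⟩ := exists_contraction hQ.isRateMatrix_reducedRate hirr
  refine ⟨_, ?_, hQ.eventually_sum_abs_flow_sub_le hπ hπB hδ hδ1 hcontr⟩
  simpa using (hQ.tendsto_fastMass.const_mul 2).add
    ((hQ.tendsto_rateDefect.const_mul (Fintype.card (Slow Q) : ℝ)).div_const δ)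

/-- The total variation distance between the two chains in terms of their flows. -/
lemma tvDist_eq [MeasurableSingletonClass S] (hQ : IsTwoTimeScale Q) {M : Matrix S S ℝ}
    {π : S → ℝ} {Ω Ω' : Type*} [MeasurableSpace Ω] [MeasurableSpace Ω'] {P : Measure Ω}
    {X : ℝ≥0 → Ω → S} (hX : IsMarkovChain P M π X) {P' : Measure Ω'}
    {N : Matrix (Slow Q) (Slow Q) ℝ} {ν : Slow Q → ℝ} {Y : ℝ≥0 → Ω' → Slow Q}
    (hY : IsMarkovChain P' N ν Y) (t : ℝ≥0) :
    tvDist (P.map (X t)) (P'.map (fun ω => (Y t ω : S))) = (1 / 2) *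
      (∑ a : Fast Q, |flow M π t a| + ∑ b : Slow Q, |flow M π t b - flow N ν t b|) := by
  have hYm : Measurable fun ω => (Y t ω : S) := measurable_subtype_coe.comp (hY.measurable t)
  have h1 : ∀ s : S, (P.map (X t)).real {s} = flow M π t s := fun s => by
    rw [map_measureReal_apply (hX.measurable t) (measurableSet_singleton s),
      hX.real_preimage_singleton]
    rfl
  have h2 : ∀ b : Slow Q, (P'.map fun ω => (Y t ω : S)).real {(b : S)} = flow N ν t b := fun b => by
    rw [map_measureReal_apply hYm (measurableSet_singleton _)]
    have : (fun ω => (Y t ω : S)) ⁻¹' {(b : S)} = Y t ⁻¹' {b} := by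
      ext ω
      simp [Subtype.ext_iff]
    rw [this, hY.real_preimage_singleton]
    rfl
  have h3 : ∀ a : Fast Q, (P'.map fun ω => (Y t ω : S)).real {(a : S)} = 0 := fun a => by
    rw [map_measureReal_apply hYm (measurableSet_singleton _)]
    have : (fun ω => (Y t ω : S)) ⁻¹' {(a : S)} = ∅ := by
      ext ω
      simpa using hQ.slow_ne_fast (Y t ω) a
    rw [this, measureReal_empty]
  rw [tvDist, hQ.sum_eq]
  simp only [h1, h2, h3, sub_zero]

end IsTwoTimeScale

theorem corollary2 {S : Type*} [Fintype S] [DecidableEq S] [MeasurableSpace S]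
    [MeasurableSingletonClass S]
    (Q : ℝ → Matrix S S ℝ) (hQ : IsTwoTimeScale Q)
    (hirr : RateIrreducible (reducedRate Q))
    (π : S → ℝ) (hπ : π ∈ stdSimplex ℝ S) (hπB : ∀ i, ¬ IsSlow Q i → π i = 0)
    {Ω : ℝ → Type*} [∀ l, MeasurableSpace (Ω l)] (P : ∀ l, Measure (Ω l))
    (X : ∀ l, ℝ≥0 → Ω l → S) (hX : ∀ l, 0 < l → IsMarkovChain (P l) (Q l) π (X l))
    {Ω' : Type*} [MeasurableSpace Ω'] (P' : Measure Ω')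
    (Y : ℝ≥0 → Ω' → Slow Q)
    (hY : IsMarkovChain P' (reducedRate Q) (fun i => π (i : S)) Y) :
    Tendsto (fun l => ⨆ t : ℝ≥0,
        tvDist ((P l).map (X l t)) (P'.map (fun ω => (Y t ω : S))))
      atTop (𝓝 0) := by
  obtain ⟨F, hF, hbound⟩ := hQ.exists_uniform_bound hirr hπ hπB
  have hF' : Tendsto (fun l => 1 / 2 * F l) atTop (𝓝 0) := by
    simpa using hF.const_mul (1 / 2 : ℝ)
  refine squeeze_zero' (Eventually.of_forall fun l => Real.iSup_nonneg fun t => ?_) ?_ hF'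
  · exact mul_nonneg (by norm_num) (Finset.sum_nonneg fun i _ => abs_nonneg _)
  · filter_upwards [eventually_gt_atTop 0, hbound] with l hl hb
    refine ciSup_le fun t => ?_
    rw [hQ.tvDist_eq (hX l hl) hY t]
    exact mul_le_mul_of_nonneg_left (hb t t.2) (by norm_num)
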